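/- Let $m\ge 2$ and let $\mathcal H=(V,E)$ be a multi-hypergraph on $V=\{1,\dots,n\}$: $E$ is a finite multiset of edges, each edge being a multiset of vertices. Suppose that $\mathcal H$ is an $m$-multigraph, i.e. every edge has exactly $m$ elements counted with multiplicity, and that $\mathcal H$ is connected: for all $u,v\in V$ there is a chain $(x_1,E_1,x_2,\dots,E_q,x_{q+1})$ with $q\ge 1$, $x_1=u$, $x_{q+1}=v$, where $x_1,\dots,x_q$ are distinct vertices, $E_1,\dots,E_q$ are distinct edges (members of the multiset $E$), and $x_k,x_{k+1}\in E_k$ for $1\le k\le q$. Let $\mathcal A=(a_{i_1\cdots i_m})$ be the adjacency tensor of $\mathcal H$: $a_{i_1\cdots i_m}=\frac1{(m-1)!}$ if $\{i_1,\dots,i_m\}$ (as a multiset) is an edge, and $a_{i_1\cdots i_m}=0$ otherwise. For $x\in\mathbb R^n$ write $$(\mathcal A x^{m-1})_i=\sum_{i_2,\dots,i_m=1}^n a_{i i_2\cdots i_m}x_{i_2}\cdots x_{i_m},\qquad \mathcal A x^m=\sum_{i_1,\dots,i_m=1}^n a_{i_1\cdots i_m}x_{i_1}\cdots x_{i_m}.$$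 A pair $(\lambda,x)\in\mathbb R\times\mathbb R^n$ is a $Z$-eigenpair of $\mathcal A$, and $\lambda$ a $Z$-eigenvalue, if $\mathcal A x^{m-1}=\lambda x$ and $x_1^2+\dots+x_n^2=1$. Let $\alpha\in\mathbb R$ be a shift with $\alpha\ge\big\lceil m\sum_{i_1,\dots,i_m=1}^n a_{i_1\cdots i_m}\big\rceil$ (for example, equal to it), and let $x_{(0)}\in\mathbb R^n$ be nonzero with nonnegative coordinates. Consider the shifted symmetric higher-order power method (SS-HOPM) $$y_{(k+1)}=\mathcal A x_{(k)}^{m-1}+\alpha x_{(k)},\qquad x_{(k+1)}=\frac{y_{(k+1)}}{\lVert y_{(k+1)}\rVert},\qquad \lambda_k=\mathcal A x_{(k)}^m\qquad(k\ge 0),$$ where $\lVert\cdot\rVert$ is the Euclidean norm. Then the method computes a $Z$-eigenvalue of $\mathcal A$: $y_{(k+1)}\ne 0$ for every $k\ge0$, so the iteration is well defined; the sequence $(\lambda_k)$ converges to a $Z$-eigenvalue $\lambda$ of $\mathcal A$; and for every accumulation point $x$ of the sequence $(x_{(k)})$, $(\lambda,x)$ is a $Z$-eigenpair of $\mathcal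 A$. -/

import Mathlib

open Filter Topology

noncomputable section

/-- A real tensor of order `m` whose dimension is the number of elements of the index type `V`. -/
abbrev RealTensor (V : Type*) (m : ℕ) : Type _ := (Fin m → V) → ℝ

/-- The vector `A x^(m-1)`: its `i`-th coordinate is the sum of
`a_{i i₂ ⋯ iₘ} x_{i₂} ⋯ x_{iₘ}` over all `i₂, …, iₘ`. The tuple `(i₁, …, iₘ)` is `j`, with
first entry `j 0 = i`. -/
def RealTensor.applyVec {V : Type*} [Fintype V] [DecidableEq V] {m : ℕ} [NeZero m]
    (A : RealTensor V m) (x : EuclideanSpace ℝ V) : EuclideanSpace ℝ V :=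
  WithLp.toLp 2 fun i =>
    ∑ j : Fin m → V with j 0 = i, A j * ∏ k ∈ Finset.univ.erase (0 : Fin m), x (j k)

/-- The homogeneous form `A x^m`. -/
def RealTensor.form {V : Type*} [Fintype V] {m : ℕ}
    (A : RealTensor V m) (x : EuclideanSpace ℝ V) : ℝ :=
  ∑ j : Fin m → V, A j * ∏ k, x (j k)

/-- `(l, x)` is a `Z`-eigenpair of `A`: both are real, `A x^(m-1) = l x` and `∑ xᵢ² = 1`. -/
def RealTensor.IsZEigenpair {V : Type*} [Fintype V] [DecidableEq V] {m : ℕ} [NeZero m]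
    (A : RealTensor V m) (l : ℝ) (x : EuclideanSpace ℝ V) : Prop :=
  A.applyVec x = l • x ∧ ∑ i, x i ^ 2 = 1

/-- `l` is a `Z`-eigenvalue of `A`. -/
def RealTensor.IsZEigenvalue {V : Type*} [Fintype V] [DecidableEq V] {m : ℕ} [NeZero m]
    (A : RealTensor V m) (l : ℝ) : Prop :=
  ∃ x : EuclideanSpace ℝ V, A.IsZEigenpair l x

/-- The unnormalized update `A x^(m-1) + α x` of the shifted symmetric higher-order power
method. -/
def RealTensor.shiftedStep {V : Type*} [Fintype V] [DecidableEq V] {m : ℕ} [NeZero m]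
    (A : RealTensor V m) (α : ℝ) (x : EuclideanSpace ℝ V) : EuclideanSpace ℝ V :=
  A.applyVec x + α • x

/-- The iterates of the shifted symmetric higher-order power method with shift `α` and starting
vector `x₀`: with `y = A x_k^(m-1) + α x_k`, the next iterate is `y / ‖y‖` (Euclidean norm). -/
def RealTensor.sshopm {V : Type*} [Fintype V] [DecidableEq V] {m : ℕ} [NeZero m]
    (A : RealTensor V m) (α : ℝ) (x₀ : EuclideanSpace ℝ V) : ℕ → EuclideanSpace ℝ V
  | 0 => x₀
  | k + 1 => ‖A.shiftedStep α (A.sshopm α x₀ k)‖⁻¹ • A.shiftedStep α (A.sshopm α x₀ k)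

/-- A multi-hypergraph on `V`: a finite multiset of edges, each edge a finite multiset of
vertices (so that both repeated edges and repeated vertices in an edge are allowed). -/
structure MultiHypergraph (V : Type*) where
  edges : Multiset (Multiset V)

/-- Every edge has exactly `m` vertices, counted with multiplicity. -/
def MultiHypergraph.IsUniform {V : Type*} (H : MultiHypergraph V) (m : ℕ) : Prop :=
  ∀ e ∈ H.edges, Multiset.card e = m

/-- A chain `(x₁, E₁, x₂, …, E_q, x_{q+1})`: the vertices `x₁, …, x_q` are distinct, `E₁, …, E_q`
are distinct members of the multiset of edges (so an edge may be used at most as often as it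
occurs there), and `x_k, x_{k+1} ∈ E_k`. -/
def MultiHypergraph.IsChain {V : Type*} (H : MultiHypergraph V) {q : ℕ}
    (x : Fin (q + 1) → V) (e : Fin q → Multiset V) : Prop :=
  Function.Injective (fun k : Fin q => x k.castSucc) ∧
  (Finset.univ : Finset (Fin q)).val.map e ≤ H.edges ∧
  ∀ k : Fin q, x k.castSucc ∈ e k ∧ x k.succ ∈ e k

/-- Any two vertices are joined by a chain of some length `q ≥ 1`. -/
def MultiHypergraph.Connected {V : Type*} (H : MultiHypergraph V) : Prop :=
  ∀ u v : V, ∃ q : ℕ, 1 ≤ q ∧ ∃ (x : Fin (q + 1) → V) (e : Fin q → Multiset V),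
    H.IsChain x e ∧ x 0 = u ∧ x (Fin.last q) = v

/-- The adjacency tensor: `a_{i₁ ⋯ iₘ}` is `1 / (m-1)!` if the multiset `{i₁, …, iₘ}` is an edge,
and `0` otherwise. -/
def MultiHypergraph.adjacencyTensor {V : Type*} [DecidableEq V] (H : MultiHypergraph V) (m : ℕ) :
    RealTensor V m :=
  fun i => 1 / ((m - 1).factorial : ℝ) *
    if (Finset.univ : Finset (Fin m)).val.map i ∈ H.edges then 1 else 0

end

/-!
The argument rests on the fact that the shift turns the power method into an ascent method for the
form `F x = A x^m` on the unit sphere. Let `G x = A x^(m-1)`, and let `S` be the sum of the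
(nonnegative) entries of the symmetric tensor `A`. Expanding each monomial to second order
(`Finset.abs_prod_sub_prod_sub_sum_le`) and using that `m • G` is the gradient of `F` by symmetry
(`RealTensor.sum_derivative_eq`) gives, for `x`, `y` in the unit ball,
`F y ≥ F x + m ⟪G x, y - x⟫ - (m (m - 1) / 2) S ‖y - x‖²` (`RealTensor.form_lower_bound`).
If `x`, `y` are unit vectors with `G x + α x = N y` and `N ≥ 0`, then
`⟪G x, y - x⟫ = ((N + α) / 2) ‖y - x‖²`, so `α ≥ m S` yields
`F y - F x ≥ (m / 2) S ‖y - x‖²` (`RealTensor.form_ascent`).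

Hence `F` increases along the iteration; being bounded by `S`, it converges, and consecutive
iterates become arbitrarily close because `S > 0`. Passing to the limit in
`G x_k + α x_k = ‖G x_k + α x_k‖ x_{k+1}` at an accumulation point `x` shows that `x` is an
eigenvector, whose eigenvalue is `⟪G x, x⟫ = F x = lim F x_k`. Accumulation points exist by
compactness of the sphere. Nonnegativity of the entries of `A` and of the iterates ensures that no
step vanishes, also at the starting vector, which need not be a unit vector.

For the adjacency tensor, connectedness is used only to produce an edge, which gives `S > 0`.
-/

/-! ### Second-order expansion of a product -/

theorem Finset.abs_prod_sub_prod_le {ι : Type*} (s : Finset ι) (a b : ι → ℝ) (d : ℝ)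
    (ha : ∀ i, |a i| ≤ 1) (hb : ∀ i, |b i| ≤ 1) (hd : ∀ i, |b i - a i| ≤ d) :
    |∏ i ∈ s, b i - ∏ i ∈ s, a i| ≤ s.card * d := by
  classical
  induction s using Finset.induction_on with
  | empty => simp
  | insert t s hts ih =>
    rw [Finset.prod_insert hts, Finset.prod_insert hts, Finset.card_insert_of_notMem hts]
    have hB : |∏ i ∈ s, b i| ≤ 1 := by
      rw [Finset.abs_prod]
      exact Finset.prod_le_one (fun _ _ => abs_nonneg _) (fun i _ => hb i)
    calc |b t * ∏ i ∈ s, b i - a t * ∏ i ∈ s, a i|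
        = |(b t - a t) * ∏ i ∈ s, b i + a t * (∏ i ∈ s, b i - ∏ i ∈ s, a i)| := by
          congr 1; ring
      _ ≤ |b t - a t| * |∏ i ∈ s, b i| + |a t| * |∏ i ∈ s, b i - ∏ i ∈ s, a i| := by
          rw [← abs_mul, ← abs_mul]; exact abs_add_le _ _
      _ ≤ d * 1 + 1 * (s.card * d) := by
          have hd0 : 0 ≤ d := (abs_nonneg _).trans (hd t)
          gcongr
          exacts [hd t, ha t]
      _ = ((s.card + 1 : ℕ) : ℝ) * d := by push_cast; ring

/-- The remainder of the first-order expansion of a product of factors in `[-1, 1]` contains one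
product of two increments for each pair of indices. -/
theorem Finset.abs_prod_sub_prod_sub_sum_le {ι : Type*} [DecidableEq ι] (s : Finset ι)
    (a b : ι → ℝ) (d : ℝ) (ha : ∀ i, |a i| ≤ 1) (hb : ∀ i, |b i| ≤ 1)
    (hd : ∀ i, |b i - a i| ≤ d) :
    |∏ i ∈ s, b i - ∏ i ∈ s, a i - ∑ i ∈ s, (b i - a i) * ∏ l ∈ s.erase i, a l| ≤
      s.card * (s.card - 1) / 2 * d ^ 2 := by
  induction s using Finset.induction_on with
  | empty => simp
  | insert t s hts ih =>
    have hsum : ∑ i ∈ insert t s, (b i - a i) * ∏ l ∈ (insert t s).erase i, a l =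
        (b t - a t) * ∏ l ∈ s, a l + a t * ∑ i ∈ s, (b i - a i) * ∏ l ∈ s.erase i, a l := by
      rw [Finset.sum_insert hts, Finset.erase_insert hts, Finset.mul_sum]
      congr 1
      refine Finset.sum_congr rfl fun i hi => ?_
      have hit : t ≠ i := fun h => hts (h ▸ hi)
      rw [Finset.erase_insert_of_ne hit,
        Finset.prod_insert (fun h => hts (Finset.mem_of_mem_erase h))]
      ring
    rw [hsum, Finset.prod_insert hts, Finset.prod_insert hts, Finset.card_insert_of_notMem hts]
    set P := ∏ i ∈ s, b i
    set Q := ∏ i ∈ s, a i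
    set R := ∑ i ∈ s, (b i - a i) * ∏ l ∈ s.erase i, a l
    calc |b t * P - a t * Q - ((b t - a t) * Q + a t * R)|
        = |(b t - a t) * (P - Q) + a t * (P - Q - R)| := by congr 1; ring
      _ ≤ |b t - a t| * |P - Q| + |a t| * |P - Q - R| := by
          rw [← abs_mul, ← abs_mul]; exact abs_add_le _ _
      _ ≤ d * (s.card * d) + 1 * (s.card * (s.card - 1) / 2 * d ^ 2) := by
          have hd0 : 0 ≤ d := (abs_nonneg _).trans (hd t)
          gcongr
          exacts [hd t, s.abs_prod_sub_prod_le a b d ha hb hd, ha t]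
      _ = ((s.card + 1 : ℕ) : ℝ) * (((s.card + 1 : ℕ) : ℝ) - 1) / 2 * d ^ 2 := by
          push_cast; ring

/-! ### The form of a symmetric tensor -/

namespace RealTensor

variable {V : Type*} [Fintype V] {m : ℕ}

/-- Entries are unchanged when the indices are permuted. -/
def IsSymmetric (A : RealTensor V m) : Prop :=
  ∀ (σ : Equiv.Perm (Fin m)) (j : Fin m → V), A (j ∘ σ) = A j

theorem abs_apply_le_one {x : EuclideanSpace ℝ V} (hx : ‖x‖ = 1) (i : V) : |x i| ≤ 1 := by
  rw [← hx, ← Real.norm_eq_abs]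
  exact PiLp.norm_apply_le x i

theorem continuous_form (A : RealTensor V m) : Continuous A.form := by
  unfold form
  fun_prop

theorem form_le_sum {A : RealTensor V m} (hA : ∀ j, 0 ≤ A j) {x : EuclideanSpace ℝ V}
    (hx : ‖x‖ = 1) : A.form x ≤ ∑ j, A j := by
  refine Finset.sum_le_sum fun j _ => mul_le_of_le_one_right (hA j) ?_
  refine (le_abs_self _).trans ?_
  rw [Finset.abs_prod]
  exact Finset.prod_le_one (fun _ _ => abs_nonneg _) (fun k _ => abs_apply_le_one hx _)

variable [DecidableEq V] [NeZero m]

theorem continuous_applyVec (A : RealTensor V m) : Continuous A.applyVec := by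
  unfold applyVec
  fun_prop

theorem continuous_shiftedStep (A : RealTensor V m) (α : ℝ) : Continuous (A.shiftedStep α) := by
  unfold shiftedStep
  exact A.continuous_applyVec.add (continuous_id.const_smul α)

theorem inner_applyVec (A : RealTensor V m) (x z : EuclideanSpace ℝ V) :
    inner ℝ (A.applyVec x) z =
      ∑ j, A j * (z (j 0) * ∏ k ∈ Finset.univ.erase (0 : Fin m), x (j k)) := by
  rw [PiLp.inner_apply, ← Finset.sum_fiberwise Finset.univ (fun j : Fin m → V => j 0)]
  refine Finset.sum_congr rfl fun i _ => ?_
  simp only [applyVec, RCLike.inner_apply, conj_trivial]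
  rw [Finset.mul_sum]
  refine Finset.sum_congr rfl fun j hj => ?_
  rw [(Finset.mem_filter.mp hj).2]
  ring

theorem inner_applyVec_self (A : RealTensor V m) (x : EuclideanSpace ℝ V) :
    inner ℝ (A.applyVec x) x = A.form x := by
  rw [inner_applyVec, form]
  refine Finset.sum_congr rfl fun j _ => ?_
  rw [Finset.mul_prod_erase Finset.univ (fun k => x (j k)) (Finset.mem_univ _)]

/-- The derivative of `A x^m` in direction `z` is `m ⟪A x^(m-1), z⟫`: by symmetry all `m`
positions in which `z` can replace `x` contribute the same. -/
theorem sum_derivative_eq {A : RealTensor V m} (hA : A.IsSymmetric) (x z : EuclideanSpace ℝ V) :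
    ∑ j, A j * ∑ k, z (j k) * ∏ l ∈ Finset.univ.erase k, x (j l) =
      m * inner ℝ (A.applyVec x) z := by
  have key : ∀ k : Fin m, ∑ j, A j * (z (j k) * ∏ l ∈ Finset.univ.erase k, x (j l)) =
      inner ℝ (A.applyVec x) z := by
    intro k
    rw [inner_applyVec]
    refine Fintype.sum_equiv (Equiv.arrowCongr (Equiv.swap (0 : Fin m) k) (Equiv.refl V)) _ _
      fun j => ?_
    have hj : (Equiv.arrowCongr (Equiv.swap (0 : Fin m) k) (Equiv.refl V)) j =
        j ∘ Equiv.swap 0 k := by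
      ext l; simp [Equiv.arrowCongr]
    rw [hj, hA]
    congr 2
    refine Finset.prod_equiv (Equiv.swap 0 k) (fun l => ?_) (fun l _ => by simp)
    simp [Equiv.swap_apply_eq_iff]
  simp_rw [Finset.mul_sum]
  rw [Finset.sum_comm]
  simp [key]

theorem form_lower_bound {A : RealTensor V m} (hsym : A.IsSymmetric) (hA : ∀ j, 0 ≤ A j)
    {x y : EuclideanSpace ℝ V} (hx : ‖x‖ = 1) (hy : ‖y‖ = 1) :
    A.form x + m * inner ℝ (A.applyVec x) (y - x) -
      m * (m - 1) / 2 * (∑ j, A j) * ‖y - x‖ ^ 2 ≤ A.form y := by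
  rw [← sum_derivative_eq hsym, form, form, mul_assoc, Finset.sum_mul, Finset.mul_sum,
    ← Finset.sum_add_distrib, ← Finset.sum_sub_distrib]
  refine Finset.sum_le_sum fun j _ => ?_
  have h := Finset.univ.abs_prod_sub_prod_sub_sum_le (fun k : Fin m => x (j k))
    (fun k => y (j k)) ‖y - x‖ (fun k => abs_apply_le_one hx _)
    (fun k => abs_apply_le_one hy _) (fun k => PiLp.norm_apply_le (y - x) (j k))
  rw [Finset.card_univ, Fintype.card_fin] at h
  have h2 := mul_le_mul_of_nonneg_left (neg_le_of_abs_le h) (hA j)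
  simp only [PiLp.sub_apply]
  linarith

/-- A normalized shifted step from a unit vector increases the form by at least a multiple of the
squared length of the step. -/
theorem form_ascent {A : RealTensor V m} (hsym : A.IsSymmetric) (hA : ∀ j, 0 ≤ A j) {α : ℝ}
    (hα : m * ∑ j, A j ≤ α) {x y : EuclideanSpace ℝ V} (hx : ‖x‖ = 1) (hy : ‖y‖ = 1) {N : ℝ}
    (hN : 0 ≤ N) (hstep : A.shiftedStep α x = N • y) :
    m / 2 * (∑ j, A j) * ‖y - x‖ ^ 2 ≤ A.form y - A.form x := by
  have hG : A.applyVec x = N • y - α • x := by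
    rw [← hstep, shiftedStep, add_sub_cancel_right]
  have hsq : ‖y - x‖ ^ 2 = 2 * (1 - inner ℝ x y) := by
    rw [norm_sub_sq_real, hx, hy, real_inner_comm]; ring
  have hinner : inner ℝ (A.applyVec x) (y - x) = (N + α) / 2 * ‖y - x‖ ^ 2 := by
    rw [hG, hsq]
    simp only [inner_sub_left, inner_sub_right, real_inner_smul_left, real_inner_self_eq_norm_sq,
      hx, hy, real_inner_comm x y]
    ring
  have hlow := form_lower_bound hsym hA hx hy
  rw [hinner] at hlow
  have hgap : 0 ≤ (m : ℝ) / 2 * (N + (α - m * ∑ j, A j)) * ‖y - x‖ ^ 2 := by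
    have := sub_nonneg.mpr hα
    positivity
  linarith

/-! ### The iteration -/

theorem applyVec_nonneg {A : RealTensor V m} (hA : ∀ j, 0 ≤ A j) {x : EuclideanSpace ℝ V}
    (hx : ∀ i, 0 ≤ x i) (i : V) : 0 ≤ A.applyVec x i :=
  Finset.sum_nonneg fun j _ => mul_nonneg (hA j) (Finset.prod_nonneg fun _ _ => hx _)

theorem shiftedStep_nonneg {A : RealTensor V m} (hA : ∀ j, 0 ≤ A j) {α : ℝ} (hα : 0 ≤ α)
    {x : EuclideanSpace ℝ V} (hx : ∀ i, 0 ≤ x i) (i : V) : 0 ≤ A.shiftedStep α x i :=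
  add_nonneg (applyVec_nonneg hA hx i) (mul_nonneg hα (hx i))

theorem shiftedStep_ne_zero {A : RealTensor V m} (hA : ∀ j, 0 ≤ A j) {α : ℝ} (hα : 0 < α)
    {x : EuclideanSpace ℝ V} (hx : ∀ i, 0 ≤ x i) (hx0 : x ≠ 0) : A.shiftedStep α x ≠ 0 := by
  intro h
  refine hx0 (PiLp.ext fun i => ?_)
  have hi : A.applyVec x i + α * x i = 0 := congrArg (fun v : EuclideanSpace ℝ V => v i) h
  have hprod : α * x i = 0 :=
    le_antisymm (by linarith [applyVec_nonneg hA hx i]) (mul_nonneg hα.le (hx i))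
  exact (mul_eq_zero.mp hprod).resolve_left hα.ne'

theorem sshopm_nonneg_ne_zero {A : RealTensor V m} (hA : ∀ j, 0 ≤ A j) {α : ℝ} (hα : 0 < α)
    {x₀ : EuclideanSpace ℝ V} (hx : ∀ i, 0 ≤ x₀ i) (hx0 : x₀ ≠ 0) (k : ℕ) :
    (∀ i, 0 ≤ A.sshopm α x₀ k i) ∧ A.sshopm α x₀ k ≠ 0 := by
  induction k with
  | zero => exact ⟨hx, hx0⟩
  | succ k ih =>
    refine ⟨fun i => mul_nonneg (inv_nonneg.mpr (norm_nonneg _))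
      (shiftedStep_nonneg hA hα.le ih.1 i), ?_⟩
    have h := shiftedStep_ne_zero hA hα ih.1 ih.2
    exact smul_ne_zero (inv_ne_zero (norm_ne_zero_iff.mpr h)) h

/-- Convergence of the shifted power method for a nonzero symmetric tensor with nonnegative
entries. -/
theorem sshopm_converges {A : RealTensor V m} (hsym : A.IsSymmetric) (hA : ∀ j, 0 ≤ A j)
    (hS : 0 < ∑ j, A j) {α : ℝ} (hα : m * ∑ j, A j ≤ α) {x₀ : EuclideanSpace ℝ V}
    (hx : ∀ i, 0 ≤ x₀ i) (hx0 : x₀ ≠ 0) :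
    (∀ k : ℕ, A.shiftedStep α (A.sshopm α x₀ k) ≠ 0) ∧
    ∃ l : ℝ, A.IsZEigenvalue l ∧
      Tendsto (fun k => A.form (A.sshopm α x₀ k)) atTop (𝓝 l) ∧
      ∀ x : EuclideanSpace ℝ V, MapClusterPt x atTop (A.sshopm α x₀) → A.IsZEigenpair l x := by
  have hm0 : (0 : ℝ) < m := Nat.cast_pos.mpr (NeZero.pos m)
  have hα0 : 0 < α := (mul_pos hm0 hS).trans_le hα
  set X := A.sshopm α x₀ with hX
  have hne : ∀ k, A.shiftedStep α (X k) ≠ 0 := fun k =>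
    have h := sshopm_nonneg_ne_zero hA hα0 hx hx0 k
    shiftedStep_ne_zero hA hα0 h.1 h.2
  have hrec : ∀ k, X (k + 1) = ‖A.shiftedStep α (X k)‖⁻¹ • A.shiftedStep α (X k) := fun _ => rfl
  have hstep : ∀ k, A.shiftedStep α (X k) = ‖A.shiftedStep α (X k)‖ • X (k + 1) := fun k => by
    rw [hrec, smul_inv_smul₀ (norm_ne_zero_iff.mpr (hne k))]
  -- The starting vector is not normalized, so the sphere is reached only after one step.
  have hunit : ∀ k, ‖X (k + 1)‖ = 1 := fun k => by
    rw [hrec]; exact norm_smul_inv_norm (𝕜 := ℝ) (hne k)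
  have hascent : ∀ k, m / 2 * (∑ j, A j) * ‖X (k + 1 + 1) - X (k + 1)‖ ^ 2 ≤
      A.form (X (k + 1 + 1)) - A.form (X (k + 1)) := fun k =>
    form_ascent hsym hA hα (hunit k) (hunit (k + 1)) (norm_nonneg _) (hstep (k + 1))
  have hmono : Monotone fun k => A.form (X (k + 1)) := monotone_nat_of_le_succ fun k =>
    sub_nonneg.mp (le_trans (by positivity) (hascent k))
  have hbdd : BddAbove (Set.range fun k => A.form (X (k + 1))) :=
    ⟨∑ j, A j, by rintro _ ⟨k, rfl⟩; exact form_le_sum hA (hunit k)⟩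
  obtain ⟨l, hl⟩ : ∃ l, Tendsto (fun k => A.form (X (k + 1))) atTop (𝓝 l) :=
    ⟨_, tendsto_atTop_ciSup hmono hbdd⟩
  have hlim : Tendsto (fun k => A.form (X k)) atTop (𝓝 l) :=
    (tendsto_add_atTop_iff_nat (f := fun k => A.form (X k)) 1).mp hl
  have hdiff : Tendsto (fun k => X (k + 1) - X k) atTop (𝓝 0) := by
    rw [← tendsto_add_atTop_iff_nat 1, tendsto_zero_iff_norm_tendsto_zero]
    have hc : 0 < m / 2 * (∑ j, A j) := by positivity
    have hgap : Tendsto (fun k => A.form (X (k + 1 + 1)) - A.form (X (k + 1))) atTop (𝓝 0) := by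
      simpa using ((tendsto_add_atTop_iff_nat 1).mpr hl).sub hl
    have hsq : Tendsto (fun k => ‖X (k + 1 + 1) - X (k + 1)‖ ^ 2) atTop (𝓝 0) := by
      refine squeeze_zero (fun _ => by positivity) (fun k => ?_)
        (by simpa using hgap.div_const (m / 2 * (∑ j, A j)))
      rw [le_div_iff₀ hc, mul_comm]
      exact hascent k
    simpa using hsq.sqrt
  have hclus : ∀ x, MapClusterPt x atTop X → A.IsZEigenpair l x := by
    intro x hxc
    obtain ⟨U, hU, hUx⟩ := mapClusterPt_iff_ultrafilter.mp hxc
    have hnext : Tendsto (fun k => X (k + 1)) U (𝓝 x) := by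
      simpa using hUx.add (hdiff.mono_left hU)
    have hnorm : ‖x‖ = 1 := tendsto_nhds_unique hnext.norm (by simp [hunit])
    have hform : A.form x = l :=
      tendsto_nhds_unique (A.continuous_form.continuousAt.tendsto.comp hUx) (hlim.mono_left hU)
    have hT := (A.continuous_shiftedStep α).continuousAt.tendsto.comp hUx
    have hfix : A.shiftedStep α x = ‖A.shiftedStep α x‖ • x :=
      tendsto_nhds_unique hT ((hT.norm.smul hnext).congr fun k => (hstep k).symm)
    have heig : A.applyVec x = (‖A.shiftedStep α x‖ - α) • x := by
      rw [sub_smul, ← hfix, shiftedStep, add_sub_cancel_right]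
    have hval : ‖A.shiftedStep α x‖ - α = l := by
      rw [← hform, ← inner_applyVec_self, heig, real_inner_smul_left,
        real_inner_self_eq_norm_sq, hnorm]
      ring
    exact ⟨hval ▸ heig, by rw [← EuclideanSpace.real_norm_sq_eq, hnorm, one_pow]⟩
  obtain ⟨x, -, hxc⟩ := (isCompact_sphere (0 : EuclideanSpace ℝ V) 1).exists_mapClusterPt
    (f := atTop) (u := fun k => X (k + 1)) (tendsto_principal.mpr (.of_forall fun k => by simp [hunit]))
  have hxc' : MapClusterPt x atTop X := hxc.of_comp (tendsto_add_atTop_nat 1)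
  exact ⟨hne, l, ⟨x, hclus x hxc'⟩, hlim, hclus⟩

end RealTensor

/-! ### The adjacency tensor -/

namespace MultiHypergraph

theorem Connected.exists_edge {V : Type*} {H : MultiHypergraph V} (hconn : H.Connected) (u : V) :
    ∃ e, e ∈ H.edges := by
  obtain ⟨q, hq, x, e, hchain, -, -⟩ := hconn u u
  exact ⟨e ⟨0, hq⟩, Multiset.mem_of_le hchain.2.1
    (Multiset.mem_map_of_mem e (Finset.mem_univ_val _))⟩

variable {V : Type*} [DecidableEq V] (H : MultiHypergraph V) (m : ℕ)

theorem adjacencyTensor_nonneg (j : Fin m → V) : 0 ≤ H.adjacencyTensor m j := by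
  unfold adjacencyTensor
  split_ifs <;> positivity

theorem adjacencyTensor_isSymmetric [Fintype V] : (H.adjacencyTensor m).IsSymmetric := by
  intro σ j
  have h : (Finset.univ : Finset (Fin m)).val.map (j ∘ σ) = Finset.univ.val.map j := by
    rw [← Multiset.map_map, Multiset.map_univ_val_equiv]
  simp only [adjacencyTensor, h]

variable {H m}

theorem sum_adjacencyTensor_pos [Fintype V] (hunif : H.IsUniform m) {e : Multiset V}
    (he : e ∈ H.edges) : 0 < ∑ j, H.adjacencyTensor m j := by
  obtain ⟨j, hj⟩ : ∃ j : Fin m → V, (Finset.univ : Finset (Fin m)).val.map j = e := by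
    have hcard := hunif e he
    induction e using Quotient.inductionOn with
    | h L =>
      obtain rfl : L.length = m := hcard
      exact ⟨L.get, by rw [Fin.univ_val_map, List.ofFn_get]; rfl⟩
  refine Finset.sum_pos' (fun j _ => H.adjacencyTensor_nonneg m j) ⟨j, Finset.mem_univ _, ?_⟩
  simp only [adjacencyTensor, hj, he, if_true]
  positivity

end MultiHypergraph

theorem corollary3p9 {V : Type*} [Fintype V] [DecidableEq V] (m : ℕ) [NeZero m] (hm : 2 ≤ m)
    (H : MultiHypergraph V) (hunif : H.IsUniform m) (hconn : H.Connected)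
    (α : ℝ) (hα : (⌈(m : ℝ) * ∑ i : Fin m → V, H.adjacencyTensor m i⌉ : ℝ) ≤ α)
    (x₀ : EuclideanSpace ℝ V) (hx₀_nonneg : ∀ i, 0 ≤ x₀ i) (hx₀_ne : x₀ ≠ 0) :
    (∀ k : ℕ, (H.adjacencyTensor m).shiftedStep α ((H.adjacencyTensor m).sshopm α x₀ k) ≠ 0) ∧
    ∃ l : ℝ, (H.adjacencyTensor m).IsZEigenvalue l ∧
      Tendsto (fun k => (H.adjacencyTensor m).form ((H.adjacencyTensor m).sshopm α x₀ k))
        atTop (𝓝 l) ∧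
      ∀ x : EuclideanSpace ℝ V,
        MapClusterPt x atTop ((H.adjacencyTensor m).sshopm α x₀) →
          (H.adjacencyTensor m).IsZEigenpair l x := by
  obtain ⟨u⟩ : Nonempty V := by
    by_contra hV
    rw [not_nonempty_iff] at hV
    exact hx₀_ne (Subsingleton.elim _ _)
  obtain ⟨e, he⟩ := hconn.exists_edge u
  exact RealTensor.sshopm_converges (H.adjacencyTensor_isSymmetric m)
    (H.adjacencyTensor_nonneg m) (MultiHypergraph.sum_adjacencyTensor_pos hunif he)
    ((Int.le_ceil _).trans hα) hx₀_nonneg hx₀_ne
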